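/- Let $n$ be a positive integer and let $V$ be a $2n$-dimensional complex vector space with a nondegenerate skew-symmetric form $\langle\cdot,\cdot\rangle$. Let $G=GL(V)$, $K=Sp(V)$, $\mathfrak g=\mathrm{End}(V)$, $\mathfrak k=\mathrm{Lie}(K)$, and let $G/B$ be the variety of complete flags $V_\bullet=(V_i)_{0\le i\le 2n}$ in $V$. For $x\in\mathfrak g$ let $x^\perp$ be the adjoint of $x$, defined by $\langle x v_1,v_2\rangle=\langle v_1,x^\perp v_2\rangle$ for all $v_1,v_2\in V$, and for $v,u\in V$ let $\tau_{v,u}\in\mathfrak g$ be $\tau_{v,u}(v')=\langle u,v'\rangle v$. The tangent space of $G/B$ at $V_\bullet$ is $\mathfrak g/\mathfrak b_{V_\bullet}$, where $\mathfrak b_{V_\bullet}=\{y\in\mathfrak g : yV_i\subseteq V_i\text{ for all }i\}$. To a quadruple $(v,u,V_\bullet,x)$ with $v,u\in V$, $x\in\mathfrak g$ nilpotent and $V_\bullet$ in the Springer fibre of $x$ (that is, $xV_i\subseteq V_{i-1}$ for $1\le i\le 2n$) assign the cotangent vector of $V\times G/B$ at $(v,V_\bullet)$ given by $(a,[y])\mapsto\langle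 u,a\rangle+\mathrm{tr}(xy)$. This assignment is a bijection from the set of such quadruples onto the cotangent bundle $T^*(V\times G/B)$. Let $Y\subseteq T^*(V\times G/B)$ be the conormal variety of the $K$-action, i.e. the union, over all $K$-orbits $\mathcal O$ in $V\times G/B$, of the conormal bundles of $\mathcal O$ (the conormal bundle of $\mathcal O$ consists of the cotangent vectors at points of $\mathcal O$ that vanish on the tangent space of $\mathcal O$). Under the above identification, \[ Y=\{(v,u,V_\bullet,x)\in T^*(V\times G/B)\;:\;x^\perp-x=\tau_{v,u}+\tau_{u,v}\}. \] Moreover, $Y=\mu^{-1}(0)$, where $\mu:T^*(V\times G/B)\to\mathfrak k^*$ is the moment map of the $K$-action, $\mu(p,\xi)(y)=\xi(y_p)$, with $y_p$ the tangent vector at $p$ given by the infinitesimal action of $y\in\mathfrak k$. -/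

import Mathlib

open Filter Topology

namespace ExoticConormal

/-- A complete flag `0 = V_0 ⊂ V_1 ⊂ ⋯ ⊂ V_d = V` of subspaces with `dim V_i = i`, where
`d = dim V`. These flags are the points of the flag variety `G/B` of `G = GL(V)`. -/
@[ext]
structure CompleteFlag (V : Type*) [AddCommGroup V] [Module ℂ V] where
  sub : Fin (Module.finrank ℂ V + 1) → Submodule ℂ V
  mono : Monotone sub
  finrank_sub : ∀ i, Module.finrank ℂ (sub i) = i

section

variable {V : Type*} [AddCommGroup V] [Module ℂ V]

/-- The action `g • V_• = (g V_i)_i` of `G = GL(V)` on complete flags. -/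
noncomputable instance : MulAction (V ≃ₗ[ℂ] V) (CompleteFlag V) where
  smul g F :=
    { sub := fun i => (F.sub i).map (g : V →ₗ[ℂ] V)
      mono := fun _ _ h => Submodule.map_mono (F.mono h)
      finrank_sub := fun i => by
        rw [← F.finrank_sub i]
        exact LinearEquiv.finrank_map_eq g (F.sub i) }
  one_smul F := CompleteFlag.ext (funext fun i => Submodule.map_id (F.sub i))
  mul_smul g h F := CompleteFlag.ext (funext fun i =>
    Submodule.map_comp (h : V →ₗ[ℂ] V) (g : V →ₗ[ℂ] V) (F.sub i))

/-- The Lie algebra `Lie(Stab_G(V_•)) = {y ∈ End V : y V_i ⊆ V_i for all i}` (as a subspace of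
`𝔤 = End V`) of the stabilizer (a Borel subgroup) of the flag `V_•`. -/
def borel (F : CompleteFlag V) : Submodule ℂ (Module.End ℂ V) where
  carrier := {y | ∀ i, ∀ w ∈ F.sub i, y w ∈ F.sub i}
  zero_mem' := fun i _ _ => (F.sub i).zero_mem
  add_mem' := fun ha hb i w hw => (F.sub i).add_mem (ha i w hw) (hb i w hw)
  smul_mem' := fun c _ ha i w hw => (F.sub i).smul_mem c (ha i w hw)

/-- The Springer fibre of `x`: flags `V_•` such that `x V_i ⊆ V_{i-1}` for `1 ≤ i ≤ dim V`. -/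
def springerFibre (x : Module.End ℂ V) : Set (CompleteFlag V) :=
  {F | ∀ i : Fin (Module.finrank ℂ V), ∀ w ∈ F.sub i.succ, x w ∈ F.sub i.castSucc}

/-! ### The cotangent bundle of `X = V × G/B` -/

/-- The tangent space of `X = V × G/B` at `(v, V_•)`. The tangent space of `G/B` at `V_•` is
`𝔤 / Lie(Stab_G(V_•))`, the class of `y` being the velocity at `t = 0` of `t ↦ exp(ty) V_•`. -/
abbrev TangentSpace (p : V × CompleteFlag V) : Type _ :=
  V × (Module.End ℂ V ⧸ borel p.2)

/-- The cotangent bundle `T*X` of `X = V × G/B`: pairs of a point and a cotangent vector there. -/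
abbrev CotangentBundle (V : Type*) [AddCommGroup V] [Module ℂ V] : Type _ :=
  Σ p : V × CompleteFlag V, Module.Dual ℂ (TangentSpace p)

/-- `γ : ℂ → W` is holomorphic near `0` with derivative `γ'(0) = w` (in coordinates; to be used
for finite-dimensional `W`, where no choice of norm is then needed). -/
def HolomorphicWithVelocity {W : Type*} [AddCommGroup W] [Module ℂ W] (γ : ℂ → W) (w : W) : Prop :=
  ∀ φ : Module.Dual ℂ W, AnalyticAt ℂ (fun t => φ (γ t)) 0 ∧ HasDerivAt (fun t => φ (γ t)) (φ w) 0

/-- The tangent vectors at `p = (v, V_•)` to a subset `O` of `X = V × G/B` (used for the orbits,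
which are complex submanifolds of `X`): the velocities at `t = 0` of germs of holomorphic curves
through `p` contained in `O`. A germ of a holomorphic curve in `G/B` through `V_•` has the form
`t ↦ g(t) V_•` with `g(t) ∈ G` holomorphic and `g(0) = 1`; its velocity is the class of `g'(0)`
in `𝔤 / Lie(Stab_G(V_•))`. -/
def tangentVectors (O : Set (V × CompleteFlag V)) (p : V × CompleteFlag V) :
    Set (TangentSpace p) :=
  {w | ∃ (a : ℂ → V) (a' : V) (g : ℂ → (V ≃ₗ[ℂ] V)) (g' : Module.End ℂ V),
    a 0 = p.1 ∧ HolomorphicWithVelocity a a' ∧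
    g 0 = 1 ∧ HolomorphicWithVelocity (fun t => (g t : Module.End ℂ V)) g' ∧
    (∀ᶠ t in 𝓝 (0 : ℂ), (a t, g t • p.2) ∈ O) ∧
    w = (a', (borel p.2).mkQ g')}

/-- The conormal bundle over `O ⊆ X`: cotangent vectors of `X` at the points of `O` which vanish
on all vectors tangent to `O`. -/
def conormalBundle (O : Set (V × CompleteFlag V)) : Set (CotangentBundle V) :=
  {ξ | ξ.1 ∈ O ∧ ∀ w ∈ tangentVectors O ξ.1, ξ.2 w = 0}

/-! ### The symplectic group -/

/-- `K = Sp(V)`, the group of linear automorphisms of `V` preserving the form `ω`. -/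
def Sp (ω : LinearMap.BilinForm ℂ V) : Subgroup (V ≃ₗ[ℂ] V) where
  carrier := {g | ∀ a b, ω (g a) (g b) = ω a b}
  one_mem' := fun _ _ => rfl
  mul_mem' := fun {g h} hg hh a b => (hg (h a) (h b)).trans (hh a b)
  inv_mem' := fun {g} hg a b => by
    have h := hg (g⁻¹ a) (g⁻¹ b)
    have e : ∀ c, g (g⁻¹ c) = c := fun c => LinearEquiv.apply_symm_apply g c
    rw [e, e] at h
    exact h.symm

/-- `𝔨 = Lie(K)`: the `y ∈ End V` with `ω(y a, b) = ω(a, -y b)` for all `a`, `b`. -/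
abbrev LieSp (ω : LinearMap.BilinForm ℂ V) : Submodule ℂ (Module.End ℂ V) :=
  LinearMap.skewAdjointSubmodule ω

/-- The conormal variety of the action of `K = Sp(V)` on `X = V × G/B`: the union of the conormal
bundles over all `K`-orbits. -/
def conormalVariety (ω : LinearMap.BilinForm ℂ V) : Set (CotangentBundle V) :=
  ⋃ p : V × CompleteFlag V, conormalBundle (MulAction.orbit (Sp ω) p)

/-- The infinitesimal action of `y ∈ 𝔤` at `p = (v, V_•)`, i.e. the velocity at `t = 0` of
`t ↦ (exp(ty) v, exp(ty) V_•)`. -/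
def infinitesimalAction (p : V × CompleteFlag V) : Module.End ℂ V →ₗ[ℂ] TangentSpace p :=
  LinearMap.prod (LinearMap.applyₗ p.1) (borel p.2).mkQ

/-- The moment map `μ : T*X → 𝔨*` of the `K`-action: `μ(p, ξ)(y) = ξ(y_p)`, where `y_p` is the
value at `p` of the vector field on `X` given by `y ∈ 𝔨`. -/
def momentMap (ω : LinearMap.BilinForm ℂ V) (ξ : CotangentBundle V) :
    Module.Dual ℂ (LieSp ω) :=
  ξ.2 ∘ₗ infinitesimalAction ξ.1 ∘ₗ (LieSp ω).subtype

/-! ### Description of the cotangent bundle by quadruples -/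

variable (V) in
/-- Quadruples `(v, u, V_•, x)` with `v, u ∈ V`, `x` nilpotent, and `V_•` in the Springer fibre
of `x`. -/
structure Quadruple where
  v : V
  u : V
  flag : CompleteFlag V
  x : Module.End ℂ V
  nilpotent : IsNilpotent x
  mem_springerFibre : flag ∈ springerFibre x

/-- If `V_•` lies in the Springer fibre of `x`, then `tr(x y) = 0` for `y ∈ Lie(Stab_G(V_•))`. -/
theorem trace_mul_eq_zero [FiniteDimensional ℂ V] {x : Module.End ℂ V} {F : CompleteFlag V}
    (hx : F ∈ springerFibre x) {y : Module.End ℂ V} (hy : y ∈ borel F) :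
    LinearMap.trace ℂ V (x * y) = 0 := by
  have key : ∀ k : ℕ, ∀ i : Fin (Module.finrank ℂ V + 1), (i : ℕ) ≤ k →
      ∀ w ∈ F.sub i, ((x * y) ^ k) w = 0 := by
    intro k
    induction k with
    | zero =>
      intro i hi w hw
      have h0 : F.sub i = ⊥ := by
        apply Submodule.finrank_eq_zero.mp
        rw [F.finrank_sub]
        omega
      rw [h0, Submodule.mem_bot] at hw
      simp [hw]
    | succ k ih =>
      intro i
      refine Fin.cases ?_ ?_ i
      · intro _ w hw
        have h0 : F.sub 0 = ⊥ := by
          apply Submodule.finrank_eq_zero.mp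
          rw [F.finrank_sub]
          rfl
        rw [h0, Submodule.mem_bot] at hw
        simp [hw]
      · intro j hj w hw
        rw [pow_succ]
        refine ih j.castSucc ?_ _ (hx j _ (hy j.succ w hw))
        simpa using hj
  have htop : F.sub (Fin.last _) = ⊤ := by
    apply Submodule.eq_top_of_finrank_eq
    rw [F.finrank_sub]
    rfl
  have hnil : IsNilpotent (x * y) := by
    refine ⟨Module.finrank ℂ V, LinearMap.ext fun w => ?_⟩
    exact key _ (Fin.last _) le_rfl w (by rw [htop]; trivial)
  exact (LinearMap.isNilpotent_trace_of_isNilpotent hnil).eq_zero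

/-- The cotangent vector of `X` described by the quadruple `(v, u, V_•, x)`: the linear form
`(a, [y]) ↦ ω(u, a) + tr(x y)` on the tangent space at `(v, V_•)`. That is, `V*` is identified
with `V` by `u ↦ ω(u, ·)`, and `𝔤*` with `𝔤` by the trace form. -/
noncomputable def Quadruple.toCotangent [FiniteDimensional ℂ V] (ω : LinearMap.BilinForm ℂ V)
    (q : Quadruple V) : CotangentBundle V :=
  ⟨(q.v, q.flag), LinearMap.coprod (ω q.u)
    ((borel q.flag).liftQ (LinearMap.trace ℂ V ∘ₗ LinearMap.mulLeft ℂ q.x)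
      fun _ hy => trace_mul_eq_zero q.mem_springerFibre hy)⟩

/-- `τ_{v,u} ∈ End V`, `τ_{v,u}(v') = ω(u, v') v`. -/
def tau (ω : LinearMap.BilinForm ℂ V) (v u : V) : Module.End ℂ V :=
  (ω u).smulRight v

/-- The adjoint `x^⊥` of `x ∈ End V` with respect to a nondegenerate form `ω`; see
`apply_eq_apply_perp` for its characterization. -/
noncomputable def perp [FiniteDimensional ℂ V] (ω : LinearMap.BilinForm ℂ V)
    (hω : ω.Nondegenerate) (x : Module.End ℂ V) : Module.End ℂ V :=
  LinearMap.BilinForm.leftAdjointOfNondegenerate ω.flip hω.flip x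

theorem apply_eq_apply_perp [FiniteDimensional ℂ V] (ω : LinearMap.BilinForm ℂ V)
    (hω : ω.Nondegenerate) (x : Module.End ℂ V) (a b : V) :
    ω (x a) b = ω a (perp ω hω x b) :=
  (LinearMap.BilinForm.isAdjointPairLeftAdjointOfNondegenerate ω.flip hω.flip x b a).symm

end

end ExoticConormal

open ExoticConormal

/-! Put `z = x + τ_{v,u}`. The covector of `(v, u, V_•, x)` takes the value `tr(z y)` on the
infinitesimal action of `y`, and since `τ_{v,u}^⊥ = -τ_{u,v}`, the displayed equation says exactly
`z^⊥ = z`. The proof is a cycle: equation, then `μ = 0`, then conormal, then equation.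

Self-adjoint and skew-adjoint maps are trace-orthogonal, so the equation gives `μ = 0`. A conormal
covector kills the velocities of symplectic transvections, so `ω(w, z w) = 0` for all `w`, and
polarization gives `z^⊥ = z`.

The hard step is `μ = 0` to conormal: every velocity of a curve `(a(t), g(t) V_•)` in the orbit must
come from `𝔨`. Pointwise the curve is `k_t • (v, V_•)`, but `k_t` need not vary holomorphically.
Instead, `h = g⁻¹k` and `h' = k⁻¹g` in `borel` solve a system linear in `(h, h')`
(`transporterMap`); treating `h'` as a separate unknown removes the quadratic condition on `k`. Its
rank at `t` is at most that at `0`, so the equation linearized at `t = 0` is solvable, and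
skew-symmetrizing a solution yields an element of `𝔨`. -/

namespace ExoticConormal

variable {V : Type*} [AddCommGroup V] [Module ℂ V]

/-! ### Quadruples and the cotangent bundle -/

section CotangentBundle

theorem CompleteFlag.sub_zero [FiniteDimensional ℂ V] (F : CompleteFlag V) : F.sub 0 = ⊥ :=
  Submodule.finrank_eq_zero.mp (F.finrank_sub 0)

theorem CompleteFlag.sub_last [FiniteDimensional ℂ V] (F : CompleteFlag V) :
    F.sub (Fin.last _) = ⊤ :=
  Submodule.eq_top_of_finrank_eq (F.finrank_sub _)

theorem isNilpotent_of_mem_springerFibre [FiniteDimensional ℂ V] {x : Module.End ℂ V}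
    {F : CompleteFlag V} (hx : F ∈ springerFibre x) : IsNilpotent x := by
  have key : ∀ i : Fin (Module.finrank ℂ V + 1), ∀ w ∈ F.sub i, (x ^ (i : ℕ)) w = 0 := by
    intro i
    induction i using Fin.induction with
    | zero =>
      intro w hw
      rw [F.sub_zero, Submodule.mem_bot] at hw
      simp [hw]
    | succ i ih =>
      intro w hw
      rw [Fin.val_succ, pow_succ]
      exact ih _ (hx i w hw)
  exact ⟨_, LinearMap.ext fun w => key (Fin.last _) w (by rw [F.sub_last]; trivial)⟩

theorem trace_mul_smulRight [FiniteDimensional ℂ V] (x : Module.End ℂ V) (f : Module.Dual ℂ V)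
    (w : V) : LinearMap.trace ℂ V (x * f.smulRight w) = f (x w) := by
  have h : x * f.smulRight w = f.smulRight (x w) := by
    ext c
    simp
  rw [h, LinearMap.trace_smulRight]

theorem ext_of_trace_mul [FiniteDimensional ℂ V] {x x' : Module.End ℂ V}
    (h : ∀ y, LinearMap.trace ℂ V (x * y) = LinearMap.trace ℂ V (x' * y)) : x = x' := by
  ext w
  rw [← sub_eq_zero, ← Module.forall_dual_apply_eq_zero_iff ℂ]
  intro f
  rw [map_sub, ← trace_mul_smulRight, ← trace_mul_smulRight, h, sub_self]

theorem exists_trace_mul_eq [FiniteDimensional ℂ V] (φ : Module.Dual ℂ (Module.End ℂ V)) :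
    ∃ x, ∀ y, LinearMap.trace ℂ V (x * y) = φ y := by
  let T : Module.End ℂ V →ₗ[ℂ] Module.Dual ℂ (Module.End ℂ V) :=
    (LinearMap.mul ℂ (Module.End ℂ V)).compr₂ (LinearMap.trace ℂ V)
  have hT : Function.Injective T := fun x x' h =>
    ext_of_trace_mul fun y => LinearMap.congr_fun h y
  obtain ⟨x, hx⟩ := (LinearMap.injective_iff_surjective_of_finrank_eq_finrank
    (Subspace.dual_finrank_eq).symm).mp hT φ
  exact ⟨x, fun y => LinearMap.congr_fun hx y⟩

/-- Tested on rank-one maps `c ↦ f(c) w` with `w ∈ V_i` and `f` vanishing on `V_{i-1}`: these lie in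
`borel F`, because `f` kills the smaller steps of the flag and the larger ones contain `w`. -/
theorem mem_springerFibre_of_trace_mul_eq_zero [FiniteDimensional ℂ V] {x : Module.End ℂ V}
    {F : CompleteFlag V} (h : ∀ y ∈ borel F, LinearMap.trace ℂ V (x * y) = 0) :
    F ∈ springerFibre x := by
  intro i w hw
  by_contra hxw
  obtain ⟨f, hf, hfF⟩ := Submodule.exists_dual_map_eq_bot_of_notMem hxw inferInstance
  refine hf ?_
  rw [← trace_mul_smulRight]
  refine h _ fun j c hc => ?_
  rw [LinearMap.smulRight_apply]
  rcases le_or_gt j i.castSucc with hj | hj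
  · have : f c = 0 := by
      rw [← Submodule.mem_bot ℂ, ← hfF]
      exact Submodule.mem_map_of_mem (F.mono hj hc)
    rw [this, zero_smul]
    exact Submodule.zero_mem _
  · exact Submodule.smul_mem _ _ (F.mono (Fin.castSucc_lt_iff_succ_le.mp hj) hw)

theorem toCotangent_apply [FiniteDimensional ℂ V] (ω : LinearMap.BilinForm ℂ V) (q : Quadruple V)
    (a : V) (y : Module.End ℂ V) :
    (q.toCotangent ω).2 ((a, (borel q.flag).mkQ y) : TangentSpace (q.toCotangent ω).1) =
      ω q.u a + LinearMap.trace ℂ V (q.x * y) :=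
  rfl

theorem toCotangent_injective [FiniteDimensional ℂ V] {ω : LinearMap.BilinForm ℂ V}
    (hω : ω.Nondegenerate) :
    Function.Injective (Quadruple.toCotangent ω : Quadruple V → CotangentBundle V) := by
  rintro ⟨v, u, F, x, hx, hF⟩ ⟨v', u', F', x', hx', hF'⟩ h
  have h1 : (v, F) = (v', F') := congrArg Sigma.fst h
  obtain ⟨rfl, rfl⟩ := Prod.mk.inj h1
  have h2 := eq_of_heq (Sigma.mk.inj h).2
  have hu : u = u' := by
    apply (ω.toDual hω).injective
    ext a
    simpa [LinearMap.BilinForm.toDual_def] using LinearMap.congr_fun h2 (a, 0)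
  have hxx : x = x' := ext_of_trace_mul fun y => by
    have h3 := LinearMap.congr_fun h2 (0, (borel F).mkQ y)
    simp only [LinearMap.coprod_apply, map_zero, zero_add] at h3
    exact h3
  subst hu hxx
  rfl

theorem toCotangent_surjective [FiniteDimensional ℂ V] {ω : LinearMap.BilinForm ℂ V}
    (hω : ω.Nondegenerate) :
    Function.Surjective (Quadruple.toCotangent ω : Quadruple V → CotangentBundle V) := by
  rintro ⟨⟨v, F⟩, ξ⟩
  obtain ⟨x, hx⟩ := exists_trace_mul_eq (ξ ∘ₗ LinearMap.inr ℂ V _ ∘ₗ (borel F).mkQ)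
  have hF : F ∈ springerFibre x := mem_springerFibre_of_trace_mul_eq_zero fun y hy => by
    have h0 : (borel F).mkQ y = 0 := by simpa using hy
    rw [hx, LinearMap.comp_apply, LinearMap.comp_apply, h0, map_zero, map_zero]
  refine ⟨⟨v, (ω.toDual hω).symm (ξ ∘ₗ LinearMap.inl ℂ V _), F, x,
    isNilpotent_of_mem_springerFibre hF, hF⟩, ?_⟩
  refine Sigma.ext rfl (heq_of_eq ?_)
  refine LinearMap.ext fun ⟨a, y⟩ => ?_
  obtain ⟨y, rfl⟩ := (borel F).mkQ_surjective y
  refine (toCotangent_apply ω _ a y).trans ?_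
  rw [LinearMap.BilinForm.apply_toDual_symm_apply, hx]
  simp only [LinearMap.comp_apply, LinearMap.inl_apply, LinearMap.inr_apply]
  rw [← map_add, Prod.mk_add_mk, add_zero, zero_add]
  rfl

end CotangentBundle

/-! ### Symplectic transvections as curves in the orbit -/

section Transvection

variable {ω : LinearMap.BilinForm ℂ V}

theorem mem_lieSp {y : Module.End ℂ V} : y ∈ LieSp ω ↔ ∀ a b, ω (y a) b = -ω a (y b) := by
  rw [LinearMap.mem_skewAdjointSubmodule]
  refine forall₂_congr fun a b => ?_
  rw [Pi.neg_apply, map_neg]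

/-- The symplectic transvection `c ↦ c + t ω(w, c) w`. -/
noncomputable def symplecticTransvection (hskew : ω.IsAlt) (w : V) (t : ℂ) : V ≃ₗ[ℂ] V :=
  LinearEquiv.transvection (f := t • ω w) (v := w) (by simp [hskew w])

theorem symplecticTransvection_apply (hskew : ω.IsAlt) (w : V) (t : ℂ) (c : V) :
    symplecticTransvection hskew w t c = c + t • tau ω w w c := by
  rw [symplecticTransvection, LinearEquiv.transvection.apply, tau, LinearMap.smulRight_apply,
    LinearMap.smul_apply, smul_assoc]

theorem symplecticTransvection_mem_Sp (hskew : ω.IsAlt) (w : V) (t : ℂ) :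
    symplecticTransvection hskew w t ∈ Sp ω := by
  intro a b
  simp only [symplecticTransvection_apply, tau, LinearMap.smulRight_apply, map_add, map_smul,
    LinearMap.add_apply, LinearMap.smul_apply, smul_eq_mul, hskew w]
  rw [← LinearMap.IsAlt.neg hskew a w]
  ring

theorem holomorphicWithVelocity_add_smul {W : Type*} [AddCommGroup W] [Module ℂ W] (a b : W) :
    HolomorphicWithVelocity (fun t : ℂ => a + t • b) b := by
  intro φ
  simp only [map_add, map_smul, smul_eq_mul]
  refine ⟨by fun_prop, ?_⟩
  simpa using ((hasDerivAt_id (0 : ℂ)).mul_const (φ b)).const_add (φ a)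

/-- As `τ_{w,w}² = 0`, the one-parameter group of `τ_{w,w}` is `1 + t τ_{w,w}`, which is affine in
`t`. -/
theorem infinitesimalAction_tau_self_mem_tangentVectors (hskew : ω.IsAlt)
    (p : V × CompleteFlag V) (w : V) :
    infinitesimalAction p (tau ω w w) ∈ tangentVectors (MulAction.orbit (Sp ω) p) p := by
  refine ⟨fun t => p.1 + t • tau ω w w p.1, tau ω w w p.1, symplecticTransvection hskew w,
    tau ω w w, by simp, holomorphicWithVelocity_add_smul _ _, ?_, ?_, ?_, rfl⟩
  · ext c
    simp [symplecticTransvection_apply]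
  · convert holomorphicWithVelocity_add_smul (1 : Module.End ℂ V) (tau ω w w) using 2 with t
    ext c
    simp [symplecticTransvection_apply]
  · refine Eventually.of_forall fun t =>
      ⟨⟨_, symplecticTransvection_mem_Sp hskew w t⟩, Prod.ext ?_ rfl⟩
    exact symplecticTransvection_apply hskew w t p.1

/-- Polarization of the quadratic form `w ↦ ω(w, z w)`. -/
theorem selfAdjoint_of_apply_self_eq_zero (hskew : ω.IsAlt) {z : Module.End ℂ V}
    (h : ∀ w, ω w (z w) = 0) (a b : V) : ω (z a) b = ω a (z b) := by
  have hab := h (a + b)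
  simp only [map_add, LinearMap.add_apply, h] at hab
  rw [← LinearMap.IsAlt.neg hskew b]
  linear_combination -hab

end Transvection

/-! ### Adjoints, traces and the moment map -/

section Perp

variable [FiniteDimensional ℂ V] {ω : LinearMap.BilinForm ℂ V}

theorem toCotangent_infinitesimalAction (q : Quadruple V) (y : Module.End ℂ V) :
    (q.toCotangent ω).2 (infinitesimalAction (q.toCotangent ω).1 y) =
      LinearMap.trace ℂ V ((q.x + tau ω q.v q.u) * y) := by
  have h : LinearMap.trace ℂ V (tau ω q.v q.u * y) = ω q.u (y q.v) := by
    rw [LinearMap.trace_mul_comm, tau, trace_mul_smulRight]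
  rw [add_mul, map_add, h, add_comm]
  exact toCotangent_apply ω q (y q.v) y

/-- Since `τ_{v,u}^⊥ = -τ_{u,v}`, both sides say that `x + τ_{v,u}` equals its own adjoint. -/
theorem perp_sub_eq_tau_iff (hω : ω.Nondegenerate) (hskew : ω.IsAlt) (q : Quadruple V) :
    perp ω hω q.x - q.x = tau ω q.v q.u + tau ω q.u q.v ↔
      ∀ a b, ω ((q.x + tau ω q.v q.u) a) b = ω a ((q.x + tau ω q.v q.u) b) := by
  rw [sub_eq_iff_eq_add, LinearMap.ext_iff, forall_comm]
  refine forall_congr' fun b => ?_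
  rw [← (ω.flip.toDual hω.flip).injective.eq_iff, LinearMap.ext_iff]
  refine forall_congr' fun a => ?_
  simp only [LinearMap.BilinForm.toDual_def, LinearMap.BilinForm.flip_apply, ← apply_eq_apply_perp, tau,
    LinearMap.add_apply, LinearMap.smulRight_apply, map_add, map_smul, LinearMap.smul_apply,
    smul_eq_mul]
  rw [← LinearMap.IsAlt.neg hskew a q.u]
  constructor <;> intro h <;> linear_combination h

/-- The isomorphism `V ≅ V*` given by `ω` conjugates `A` into the transpose of `B`. -/
theorem trace_eq_of_adjoint (hω : ω.Nondegenerate) {A B : Module.End ℂ V}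
    (h : ∀ a b, ω (A a) b = ω a (B b)) : LinearMap.trace ℂ V A = LinearMap.trace ℂ V B := by
  rw [← LinearMap.trace_transpose' B, ← LinearMap.trace_conj' A (ω.toDual hω)]
  congr 1
  refine LinearMap.ext fun f => ?_
  obtain ⟨a, rfl⟩ := (ω.toDual hω).surjective f
  ext b
  simp [LinearEquiv.conj_apply, LinearMap.BilinForm.toDual_def, h, Module.Dual.transpose_apply]

/-- The adjoint of `z y` is `-y z`, whence `tr(z y) = -tr(z y)`. -/
theorem trace_mul_eq_zero_of_selfAdjoint (hω : ω.Nondegenerate) {z y : Module.End ℂ V}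
    (hz : ∀ a b, ω (z a) b = ω a (z b)) (hy : y ∈ LieSp ω) :
    LinearMap.trace ℂ V (z * y) = 0 := by
  have h : LinearMap.trace ℂ V (z * y) = LinearMap.trace ℂ V (-(y * z)) := by
    refine trace_eq_of_adjoint hω fun a b => ?_
    rw [Module.End.mul_apply, hz, mem_lieSp.mp hy, LinearMap.neg_apply, map_neg,
      Module.End.mul_apply]
  rw [map_neg, LinearMap.trace_mul_comm ℂ y z] at h
  exact self_eq_neg.mp h

theorem toCotangent_mem_momentMap_zero (hω : ω.Nondegenerate) (hskew : ω.IsAlt) {q : Quadruple V}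
    (h : perp ω hω q.x - q.x = tau ω q.v q.u + tau ω q.u q.v) :
    momentMap ω (q.toCotangent ω) = 0 := by
  ext ⟨y, hy⟩
  refine (toCotangent_infinitesimalAction q y).trans ?_
  exact trace_mul_eq_zero_of_selfAdjoint hω ((perp_sub_eq_tau_iff hω hskew q).mp h) hy

theorem perp_sub_eq_tau_of_mem_conormalVariety (hω : ω.Nondegenerate) (hskew : ω.IsAlt)
    {q : Quadruple V} (h : q.toCotangent ω ∈ conormalVariety ω) :
    perp ω hω q.x - q.x = tau ω q.v q.u + tau ω q.u q.v := by
  obtain ⟨p, hp, hξ⟩ := Set.mem_iUnion.mp h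
  -- Rebases the orbit at the base point of the covector itself.
  rw [← MulAction.orbit_eq_iff.mpr hp] at hξ
  refine (perp_sub_eq_tau_iff hω hskew q).mpr (selfAdjoint_of_apply_self_eq_zero hskew fun w => ?_)
  have hw := hξ _ (infinitesimalAction_tau_self_mem_tangentVectors hskew _ w)
  rw [toCotangent_infinitesimalAction] at hw
  exact (trace_mul_smulRight _ (ω w) w).symm.trans hw

end Perp
end ExoticConormal

/-! ### Linearizing families of linear equations -/

namespace ExoticConormal

/-- If the linear maps `L t` converge pointwise to `L₀` and their ranks do not exceed that of `L₀`,
then limits of vectors in the ranges of the `L t` lie in the range of `L₀`. -/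
theorem mem_range_of_tendsto {T κ E : Type*} [Fintype κ] [AddCommGroup E] [Module ℂ E]
    [FiniteDimensional ℂ E] {l : Filter T} [l.NeBot] {L : T → E →ₗ[ℂ] (κ → ℂ)}
    {L₀ : E →ₗ[ℂ] (κ → ℂ)} (hL : ∀ e, Tendsto (fun t => L t e) l (𝓝 (L₀ e)))
    (hrank : ∀ᶠ t in l, Module.finrank ℂ (LinearMap.range (L t)) ≤
      Module.finrank ℂ (LinearMap.range L₀))
    {u : T → κ → ℂ} {u₀ : κ → ℂ} (hu : Tendsto u l (𝓝 u₀))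
    (hmem : ∀ᶠ t in l, u t ∈ LinearMap.range (L t)) : u₀ ∈ LinearMap.range L₀ := by
  by_contra h₀
  let b := Module.finBasis ℂ (LinearMap.range L₀)
  choose e he using fun i => (b i).2
  -- If `u₀` were outside the range, it would form with a basis of that range `rank L₀ + 1`
  -- independent vectors. Independence is an open condition, so nearby `L t` would have too large a
  -- rank.
  have hind : LinearIndependent ℂ
      (Fin.cons u₀ (fun i => L₀ (e i)) : Fin (Module.finrank ℂ (LinearMap.range L₀) + 1) → κ → ℂ) := by
    have hb : (fun i => L₀ (e i)) = (LinearMap.range L₀).subtype ∘ b := funext he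
    rw [linearIndependent_finCons, hb]
    refine ⟨b.linearIndependent.map' _ (Submodule.ker_subtype _), ?_⟩
    rwa [Set.range_comp, Submodule.span_image, b.span_eq, Submodule.map_top,
      Submodule.range_subtype]
  have htend : Tendsto (fun t => (Fin.cons (u t) (fun i => L t (e i)) :
      Fin (Module.finrank ℂ (LinearMap.range L₀) + 1) → κ → ℂ)) l
      (𝓝 (Fin.cons u₀ (fun i => L₀ (e i)))) := by
    rw [tendsto_pi_nhds]
    refine Fin.cases ?_ fun i => ?_
    · simpa using hu
    · simpa using hL (e i)
  obtain ⟨t, ht, hrt, hmt⟩ := ((htend.eventually hind.eventually).and (hrank.and hmem)).exists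
  have hspan : Submodule.span ℂ (Set.range (Fin.cons (u t) (fun i => L t (e i)) :
      Fin (Module.finrank ℂ (LinearMap.range L₀) + 1) → κ → ℂ)) ≤ LinearMap.range (L t) := by
    rw [Submodule.span_le]
    rintro _ ⟨i, rfl⟩
    refine Fin.cases ?_ (fun i => ?_) i
    · exact hmt
    · exact ⟨e i, rfl⟩
  have := Submodule.finrank_mono hspan
  rw [finrank_span_eq_card ht, Fintype.card_fin] at this
  omega

/-- If `L t e = w t` is solvable for all small `t`, with solution `e₀` at `t = 0`, and `L` has
constant rank, then the linearized equation at `0` is solvable. -/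
theorem exists_linearized_solution {κ E : Type*} [Fintype κ] [AddCommGroup E] [Module ℂ E]
    [FiniteDimensional ℂ E] {L : ℂ → E →ₗ[ℂ] (κ → ℂ)} {L' : E → κ → ℂ}
    (hL : ∀ e i, HasDerivAt (fun t => L t e i) (L' e i) 0)
    (hrank : ∀ᶠ t in 𝓝 (0 : ℂ), Module.finrank ℂ (LinearMap.range (L t)) ≤
      Module.finrank ℂ (LinearMap.range (L 0)))
    {w : ℂ → κ → ℂ} {w' : κ → ℂ} (hw : ∀ i, HasDerivAt (fun t => w t i) (w' i) 0)
    (hmem : ∀ᶠ t in 𝓝 (0 : ℂ), w t ∈ LinearMap.range (L t)) {e₀ : E} (he₀ : L 0 e₀ = w 0) :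
    ∃ e, ∀ i, L 0 e i + L' e₀ i = w' i := by
  have key : w' - L' e₀ ∈ LinearMap.range (L 0) := by
    -- For `t ≠ 0` the difference quotient lies in the range of `L t`, and it converges to `w' - L'
    -- e₀`.
    refine mem_range_of_tendsto (l := 𝓝[≠] (0 : ℂ)) (L := L)
      (u := fun t => t⁻¹ • (w t - L t e₀)) (fun e => ?_)
      (hrank.filter_mono nhdsWithin_le_nhds) ?_ ?_
    · exact tendsto_pi_nhds.mpr fun i =>
        (hL e i).continuousAt.tendsto.mono_left nhdsWithin_le_nhds
    · refine tendsto_pi_nhds.mpr fun i => ?_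
      have := ((hw i).sub (hL e₀ i)).tendsto_slope_zero
      simpa [he₀] using this
    · filter_upwards [hmem.filter_mono nhdsWithin_le_nhds] with t ht
      exact Submodule.smul_mem _ _ (Submodule.sub_mem _ ht ⟨e₀, rfl⟩)
  obtain ⟨e, he⟩ := key
  exact ⟨e, fun i => by rw [he]; simp⟩

variable {V : Type*} [AddCommGroup V] [Module ℂ V]

theorem HolomorphicWithVelocity.hasDerivAt_bilin [FiniteDimensional ℂ V]
    (B : LinearMap.BilinForm ℂ V) {a c : ℂ → V} {a' c' : V} (ha : HolomorphicWithVelocity a a')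
    (hc : HolomorphicWithVelocity c c') :
    HasDerivAt (fun t => B (a t) (c t)) (B a' (c 0) + B (a 0) c') 0 := by
  let b := Module.finBasis ℂ V
  have hB : ∀ x y, B x y = ∑ i, b.coord i x * B (b i) y := fun x y => by
    conv_lhs => rw [← b.sum_repr x]
    simp only [map_sum, map_smul, LinearMap.sum_apply, LinearMap.smul_apply, smul_eq_mul,
      Module.Basis.coord_apply]
  rw [funext fun t => hB (a t) (c t), hB a', hB (a 0), ← Finset.sum_add_distrib]
  refine HasDerivAt.fun_sum fun i _ => ?_
  exact (ha (b.coord i)).2.mul (hc (B (b i))).2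

theorem HolomorphicWithVelocity.apply {g : ℂ → Module.End ℂ V} {g' : Module.End ℂ V}
    (hg : HolomorphicWithVelocity g g') (c : V) : HolomorphicWithVelocity (fun t => g t c) (g' c) :=
  fun φ => hg (φ ∘ₗ LinearMap.applyₗ c)

/-! ### The linear system for transporters -/

section Transporter

variable (F : CompleteFlag V) (ω : LinearMap.BilinForm ℂ V) {ι : Type*} (b : Module.Basis ι ℂ V)

/-- The linear map on pairs `(h, h')` of elements of `borel F`, in the coordinates given by a
basis of `V`, taking the value `(0, a, ω(·, v))` exactly when `ω(g h α, g β) = ω(α, h' β)`,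
`g h v = a` and `ω(g h α, a) = ω(α, v)` for all `α`, `β`. -/
noncomputable def transporterMap (v : V) (g : Module.End ℂ V) (a : V) :
    (borel F × borel F) →ₗ[ℂ] ((ι × ι) ⊕ ι ⊕ ι → ℂ) :=
  LinearMap.pi fun k => match k with
    | .inl (i, j) =>
      ω.flip (g (b j)) ∘ₗ g ∘ₗ LinearMap.applyₗ (b i) ∘ₗ (borel F).subtype ∘ₗ LinearMap.fst ℂ _ _ -
        ω (b i) ∘ₗ LinearMap.applyₗ (b j) ∘ₗ (borel F).subtype ∘ₗ LinearMap.snd ℂ _ _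
    | .inr (.inl i) =>
      ω (b i) ∘ₗ g ∘ₗ LinearMap.applyₗ v ∘ₗ (borel F).subtype ∘ₗ LinearMap.fst ℂ _ _
    | .inr (.inr i) =>
      ω.flip a ∘ₗ g ∘ₗ LinearMap.applyₗ (b i) ∘ₗ (borel F).subtype ∘ₗ LinearMap.fst ℂ _ _

variable {F ω b} {v : V} {g : Module.End ℂ V} {a : V} (h : borel F × borel F)

@[simp]
theorem transporterMap_inl (i j : ι) : transporterMap F ω b v g a h (.inl (i, j)) =
    ω (g (h.1.1 (b i))) (g (b j)) - ω (b i) (h.2.1 (b j)) :=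
  rfl

@[simp]
theorem transporterMap_inr_inl (i : ι) : transporterMap F ω b v g a h (.inr (.inl i)) =
    ω (b i) (g (h.1.1 v)) :=
  rfl

@[simp]
theorem transporterMap_inr_inr (i : ι) : transporterMap F ω b v g a h (.inr (.inr i)) =
    ω (g (h.1.1 (b i))) a :=
  rfl

end Transporter

end ExoticConormal

namespace ExoticConormal

variable {V : Type*} [AddCommGroup V] [Module ℂ V] {F : CompleteFlag V}
  {ω : LinearMap.BilinForm ℂ V} {ι : Type*}

theorem bilin_apply_eq_of_basis (b : Module.Basis ι ℂ V) {A B C D : Module.End ℂ V}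
    (h : ∀ i j, ω (A (b i)) (B (b j)) = ω (C (b i)) (D (b j))) (α β : V) :
    ω (A α) (B β) = ω (C α) (D β) := by
  have : ω.compl₁₂ A B = ω.compl₁₂ C D := LinearMap.ext_basis b b h
  exact LinearMap.congr_fun₂ this α β

theorem eq_of_bilin_basis_eq (hω : ω.Nondegenerate) (b : Module.Basis ι ℂ V) {c d : V}
    (h : ∀ i, ω (b i) c = ω (b i) d) : c = d := by
  rw [← sub_eq_zero]
  refine hω.2 _ fun α => ?_
  have : ω.flip c = ω.flip d := b.ext h
  rw [map_sub, sub_eq_zero]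
  exact LinearMap.congr_fun this α

theorem mul_mem_borel {x y : Module.End ℂ V} (hx : x ∈ borel F) (hy : y ∈ borel F) :
    x * y ∈ borel F :=
  fun i w hw => hx i _ (hy i w hw)

theorem one_mem_borel : (1 : Module.End ℂ V) ∈ borel F :=
  fun _ _ hw => hw

theorem coe_mem_borel_of_smul_eq {k g : V ≃ₗ[ℂ] V} (h : k • F = g • F) :
    ((g⁻¹ * k : V ≃ₗ[ℂ] V) : Module.End ℂ V) ∈ borel F := by
  intro i w hw
  have hF : (g⁻¹ * k) • F = F := by rw [mul_smul, h, inv_smul_smul]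
  have hi : (F.sub i).map ((g⁻¹ * k : V ≃ₗ[ℂ] V) : Module.End ℂ V) = F.sub i :=
    congrFun (congrArg CompleteFlag.sub hF) i
  rw [← hi]
  exact Submodule.mem_map_of_mem hw

/-- The map `(h, h') ↦ (g⁻¹k h, h' k⁻¹g)` sends the kernel at `(1, v)` injectively into the kernel
at `(g, k v)`; rank-nullity turns this into the bound on ranks. -/
theorem finrank_range_transporterMap_le [FiniteDimensional ℂ V] (hω : ω.Nondegenerate)
    (b : Module.Basis ι ℂ V) {v : V} {k g : V ≃ₗ[ℂ] V} (hk : k ∈ Sp ω) (h : k • F = g • F) :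
    Module.finrank ℂ (LinearMap.range (transporterMap F ω b v (g : Module.End ℂ V) (k v))) ≤
      Module.finrank ℂ (LinearMap.range (transporterMap F ω b v 1 v)) := by
  let L₀ := transporterMap F ω b v 1 v
  let L := transporterMap F ω b v (g : Module.End ℂ V) (k v)
  have h₁ := coe_mem_borel_of_smul_eq h
  have h₂ := coe_mem_borel_of_smul_eq h.symm
  let Φ : borel F × borel F →ₗ[ℂ] borel F × borel F :=
    LinearMap.prodMap
      ((LinearMap.mulLeft ℂ ((g⁻¹ * k : V ≃ₗ[ℂ] V) : Module.End ℂ V)).restrict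
        fun _ hy => mul_mem_borel h₁ hy)
      ((LinearMap.mulRight ℂ ((k⁻¹ * g : V ≃ₗ[ℂ] V) : Module.End ℂ V)).restrict
        fun _ hy => mul_mem_borel hy h₂)
  have hΦ : Function.Injective Φ := by
    rintro ⟨⟨x, _⟩, ⟨y, _⟩⟩ ⟨⟨x', _⟩, ⟨y', _⟩⟩ hxy
    obtain ⟨hx, hy⟩ := Prod.mk.inj hxy
    have hx := congrArg Subtype.val hx
    have hy := congrArg Subtype.val hy
    refine Prod.ext (Subtype.ext (LinearMap.ext fun c => ?_))
      (Subtype.ext (LinearMap.ext fun c => ?_))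
    · exact (g⁻¹ * k).injective (LinearMap.congr_fun hx c)
    · obtain ⟨c, rfl⟩ := (k⁻¹ * g).surjective c
      exact LinearMap.congr_fun hy c
  have hker : ∀ e ∈ LinearMap.ker L₀, Φ e ∈ LinearMap.ker L := by
    rintro ⟨⟨x, hx⟩, ⟨y, hy⟩⟩ he
    have he := congrFun (LinearMap.mem_ker.mp he)
    have e₁ := bilin_apply_eq_of_basis (ω := ω) b (A := x) (B := 1) (C := 1) (D := y)
      fun i j => sub_eq_zero.mp (he (.inl (i, j)))
    have e₂ : x v = 0 := eq_of_bilin_basis_eq hω b fun i => (he (.inr (.inl i))).trans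
      (map_zero _).symm
    have e₃ : ∀ i, ω (x (b i)) v = 0 := fun i => he (.inr (.inr i))
    have hgk : ∀ c, g ((g⁻¹ * k) c) = k c := fun c => g.apply_symm_apply (k c)
    have hkg : ∀ c, k ((k⁻¹ * g) c) = g c := fun c => k.apply_symm_apply (g c)
    refine LinearMap.mem_ker.mpr (funext fun i => ?_)
    rcases i with ⟨i, j⟩ | i | i
    · change ω (g ((g⁻¹ * k) (x (b i)))) (g (b j)) - ω (b i) (y ((k⁻¹ * g) (b j))) = 0
      rw [hgk, ← hkg, hk, sub_eq_zero]
      exact e₁ _ _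
    · change ω (b i) (g ((g⁻¹ * k) (x v))) = 0
      rw [e₂, map_zero, map_zero, map_zero]
    · change ω (g ((g⁻¹ * k) (x (b i)))) (k v) = 0
      rw [hgk, hk, e₃]
  have hle : Module.finrank ℂ (LinearMap.ker L₀) ≤ Module.finrank ℂ (LinearMap.ker L) :=
    LinearMap.finrank_le_finrank_of_injective (f := Φ.restrict hker) fun e e' hee =>
      Subtype.ext (hΦ (congrArg Subtype.val hee))
  have h₃ := L.finrank_range_add_finrank_ker
  have h₄ := L₀.finrank_range_add_finrank_ker
  change Module.finrank ℂ (LinearMap.range L) ≤ Module.finrank ℂ (LinearMap.range L₀)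
  omega

/-- The solution is `(g⁻¹k, k⁻¹g)`. -/
theorem mem_range_transporterMap (b : Module.Basis ι ℂ V) {v : V} {k g : V ≃ₗ[ℂ] V}
    (hk : k ∈ Sp ω) (h : k • F = g • F) :
    (Sum.elim 0 (Sum.elim (fun i => ω (b i) (k v)) fun i => ω (b i) v) : (ι × ι) ⊕ ι ⊕ ι → ℂ) ∈
      LinearMap.range (transporterMap F ω b v (g : Module.End ℂ V) (k v)) := by
  refine ⟨(⟨_, coe_mem_borel_of_smul_eq h⟩, ⟨_, coe_mem_borel_of_smul_eq h.symm⟩),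
    funext fun i => ?_⟩
  have hgk : ∀ c, g ((g⁻¹ * k) c) = k c := fun c => g.apply_symm_apply (k c)
  have hkg : ∀ c, k ((k⁻¹ * g) c) = g c := fun c => k.apply_symm_apply (g c)
  rcases i with ⟨i, j⟩ | i | i
  · change ω (g ((g⁻¹ * k) (b i))) (g (b j)) - ω (b i) ((k⁻¹ * g) (b j)) = 0
    rw [hgk, ← hkg, hk, sub_self]
  · change ω (b i) (g ((g⁻¹ * k) v)) = ω (b i) (k v)
    rw [hgk]
  · change ω (g ((g⁻¹ * k) (b i))) (k v) = ω (b i) v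
    rw [hgk, hk]

theorem half_sub_mem_lieSp (hskew : ω.IsAlt) {x y : Module.End ℂ V}
    (h : ∀ α β, ω (x α) β = ω α (y β)) : (2⁻¹ : ℂ) • (x - y) ∈ LieSp ω := by
  rw [mem_lieSp]
  intro α β
  have h' : ω (y α) β = ω α (x β) := by
    rw [← LinearMap.IsAlt.neg hskew, ← h, LinearMap.IsAlt.neg hskew]
  simp only [LinearMap.smul_apply, LinearMap.sub_apply, map_smul, map_sub, smul_eq_mul, h, h']
  ring

/-- The tangent vectors to a `K`-orbit come from the infinitesimal action of `𝔨`. -/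
theorem exists_infinitesimalAction_eq_of_mem_tangentVectors [FiniteDimensional ℂ V]
    (hω : ω.Nondegenerate) (hskew : ω.IsAlt) {p : V × CompleteFlag V} {w : TangentSpace p}
    (hw : w ∈ tangentVectors (MulAction.orbit (Sp ω) p) p) :
    ∃ y ∈ LieSp ω, infinitesimalAction p y = w := by
  obtain ⟨v, F⟩ := p
  obtain ⟨a, a', g, g', ha₀, ha, hg₀, hg, horb, rfl⟩ := hw
  simp only at ha₀ horb
  have horb' : ∀ᶠ t in 𝓝 (0 : ℂ), ∃ k ∈ Sp ω, k v = a t ∧ k • F = g t • F := by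
    filter_upwards [horb] with t ht
    obtain ⟨⟨k, hk⟩, hkt⟩ := ht
    exact ⟨k, hk, congrArg Prod.fst hkt, congrArg Prod.snd hkt⟩
  have hg₁ : ((g 0 : V ≃ₗ[ℂ] V) : Module.End ℂ V) = 1 := by rw [hg₀]; rfl
  let b := Module.finBasis ℂ V
  -- At `t = 0` the system has `g = 1` and `a = v`, and is solved by `(1, 1)`.
  obtain ⟨⟨⟨x, hx⟩, ⟨y, hy⟩⟩, he⟩ := exists_linearized_solution
    (L := fun t => transporterMap F ω b v (g t : Module.End ℂ V) (a t))
    (L' := fun e => Sum.elim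
      (fun i => ω (g' (e.1.1 (b i.1))) (b i.2) + ω (e.1.1 (b i.1)) (g' (b i.2)))
      (Sum.elim (fun i => ω (b i) (g' (e.1.1 v)))
        fun i => ω (g' (e.1.1 (b i))) v + ω (e.1.1 (b i)) a'))
    (w := fun t => Sum.elim 0 (Sum.elim (fun i => ω (b i) (a t)) fun i => ω (b i) v))
    (w' := Sum.elim 0 (Sum.elim (fun i => ω (b i) a') 0))
    (e₀ := (⟨1, one_mem_borel⟩, ⟨1, one_mem_borel⟩))
    (by
      rintro e (⟨i, j⟩ | i | i)
      · have := (hg.apply (e.1.1 (b i))).hasDerivAt_bilin ω (hg.apply (b j))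
        simp only [hg₁] at this
        exact this.sub_const _
      · exact (hg.apply (e.1.1 v) (ω (b i))).2
      · have := (hg.apply (e.1.1 (b i))).hasDerivAt_bilin ω ha
        simp only [hg₁, ha₀] at this
        exact this)
    (by
      filter_upwards [horb'] with t ⟨k, hk, hkv, hkF⟩
      rw [← hkv, hg₁, ha₀]
      exact finrank_range_transporterMap_le hω b hk hkF)
    (by
      rintro (⟨i, j⟩ | i | i)
      · exact hasDerivAt_const _ _
      · exact (ha (ω (b i))).2
      · exact hasDerivAt_const _ _)
    (by
      filter_upwards [horb'] with t ⟨k, hk, hkv, hkF⟩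
      rw [← hkv]
      exact mem_range_transporterMap b hk hkF)
    (by
      rw [hg₁, ha₀]
      funext i
      rcases i with ⟨i, j⟩ | i | i
      · exact sub_self _
      · rfl
      · rfl)
  rw [hg₁, ha₀] at he
  have e₁ : ∀ α β, ω ((x + g') α) β = ω α ((y - g') β) :=
    bilin_apply_eq_of_basis b (B := 1) (C := 1) fun i j => by
      have := he (.inl (i, j))
      simp only [transporterMap_inl, Sum.elim_inl, Module.End.one_apply, Pi.zero_apply] at this
      simp only [LinearMap.add_apply, LinearMap.sub_apply, map_add, map_sub, Module.End.one_apply]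
      linear_combination this
  have e₂ : (x + g') v = a' := eq_of_bilin_basis_eq hω b fun i => by
    have := he (.inr (.inl i))
    simp only [transporterMap_inr_inl, Sum.elim_inl, Sum.elim_inr, Module.End.one_apply] at this
    rw [LinearMap.add_apply, map_add, this]
  have e₃ : (y - g') v = -a' := eq_of_bilin_basis_eq hω b fun i => by
    have := he (.inr (.inr i))
    simp only [transporterMap_inr_inr, Sum.elim_inr, Module.End.one_apply, Pi.zero_apply] at this
    rw [← e₁, LinearMap.add_apply, map_add, LinearMap.add_apply, map_neg]
    linear_combination this
  -- By `e₁`, `x + g'` and `y - g'` are mutually adjoint, so half their difference lies in `𝔨`. It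
  -- sends `v` to `a'` by `e₂` and `e₃`, and differs from `g'` by `(x - y)/2 ∈ borel F`.
  refine ⟨_, half_sub_mem_lieSp hskew e₁, Prod.ext ?_ ?_⟩
  · change ((2⁻¹ : ℂ) • ((x + g') - (y - g'))) v = a'
    rw [LinearMap.smul_apply, LinearMap.sub_apply, e₂, e₃]
    module
  · change (borel F).mkQ ((2⁻¹ : ℂ) • ((x + g') - (y - g'))) = (borel F).mkQ g'
    rw [← sub_eq_zero, ← map_sub, Submodule.mkQ_apply, Submodule.Quotient.mk_eq_zero]
    have : (2⁻¹ : ℂ) • ((x + g') - (y - g')) - g' = (2⁻¹ : ℂ) • (x - y) := by module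
    rw [this]
    exact Submodule.smul_mem _ _ (Submodule.sub_mem _ hx hy)

theorem mem_conormalVariety_of_momentMap_eq_zero [FiniteDimensional ℂ V]
    (hω : ω.Nondegenerate) (hskew : ω.IsAlt) {ξ : CotangentBundle V} (h : momentMap ω ξ = 0) :
    ξ ∈ conormalVariety ω := by
  refine Set.mem_iUnion.mpr ⟨ξ.1, MulAction.mem_orbit_self _, fun w hw => ?_⟩
  obtain ⟨y, hy, rfl⟩ := exists_infinitesimalAction_eq_of_mem_tangentVectors hω hskew hw
  exact LinearMap.congr_fun h ⟨y, hy⟩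

end ExoticConormal

theorem mainTheorem8 (n : ℕ) (hn : 0 < n)
    {V : Type*} [AddCommGroup V] [Module ℂ V] [FiniteDimensional ℂ V]
    (hV : Module.finrank ℂ V = 2 * n)
    (ω : LinearMap.BilinForm ℂ V) (hω : ω.Nondegenerate) (hskew : ω.IsAlt) :
    -- quadruples describe the cotangent bundle of `V × G/B`
    Function.Bijective (Quadruple.toCotangent ω : Quadruple V → CotangentBundle V) ∧
    -- the conormal variety in terms of quadruples
    Quadruple.toCotangent ω ⁻¹' conormalVariety ω =
      {q : Quadruple V | perp ω hω q.x - q.x = tau ω q.v q.u + tau ω q.u q.v} ∧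
    -- the conormal variety is the zero fibre of the moment map
    conormalVariety ω = momentMap ω ⁻¹' {0} := by
  have hperp : ∀ q : Quadruple V, q.toCotangent ω ∈ conormalVariety ω ↔
      perp ω hω q.x - q.x = tau ω q.v q.u + tau ω q.u q.v := fun q =>
    ⟨perp_sub_eq_tau_of_mem_conormalVariety hω hskew, fun h =>
      mem_conormalVariety_of_momentMap_eq_zero hω hskew (toCotangent_mem_momentMap_zero hω hskew h)⟩
  refine ⟨⟨toCotangent_injective hω, toCotangent_surjective hω⟩, Set.ext hperp,
    Set.ext fun ξ => ⟨fun h => ?_, mem_conormalVariety_of_momentMap_eq_zero hω hskew⟩⟩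
  obtain ⟨q, rfl⟩ := toCotangent_surjective hω ξ
  exact toCotangent_mem_momentMap_zero hω hskew ((hperp q).mp h)
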